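/- Let $(E,e,T)$ be a conditional Riesz triple: $E$ is a Dedekind complete Riesz space, $e\ge 0$ is a weak order unit, and $T:E\to E$ is a strictly positive, order continuous linear projection with $Te=e$ whose range $R(T)$ is a Dedekind complete Riesz subspace. For $v\in E$ let $P_v$ be the band projection onto the band generated by $v$, $P_v^d=I-P_v$, and put $$P_{x\ge y}=P^d_{(y-x)^+},\qquad P_{x\le y}=P^d_{(x-y)^+},\qquad P_{x=y}=P^d_{|x-y|}\qquad(x,y\in E).$$ Let $\pi_x(n)=TP_{x=ne}e$. An element $x\in E$ is called natural if $\sum_{n=0}^\infty \pi_x(n)=e$ (order limit of the partial sums). Let $E^s$ be the sup-completion of $E$, whose positive cone carries the multiplication with unit $e$. The generating function of a natural element $x$ is $g_x(s)=\sum_{n\ge 0}s^n\pi_x(n)\in E^s$ for $s\ge 0$, and for $s>0$ and $v\in E$ the element $s^v=f(v)\in E^s$ with $f(t)=s^t$ is defined by the functional calculus, i.e. the Daniell integral of $f$ with respect to the spectral system $(P_{v\le te}e)_{t\in\mathbb R}$. Theorem (Chernoff bounds). Let $x$ be a natural element of $E$. Then for every $u\in R(T)$, with inequalities in $E^s$,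 $$TP_{x\ge u}e\le s^{-u}g_x(s)\quad\text{for all } s>1,$$ $$TP_{x\le u}e\le s^{-u}g_x(s)\quad\text{for all } 0<s<1.$$ In particular, for every real $\alpha\ge 0$, $$TP_{x\ge \alpha e}e\le \frac{g_x(s)}{s^{\alpha}}\quad\text{for all } s>1,\qquad TP_{x\le \alpha e}e\le \frac{g_x(s)}{s^{\alpha}}\quad\text{for all } 0<s<1.$$ -/

import Mathlib

open scoped NNReal

noncomputable section

namespace RieszSpace

/-! Throughout, a Dedekind complete Riesz space is a real vector space with a
conditionally complete lattice order compatible with the linear structure. -/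

section Projections

variable {E : Type*} [AddCommGroup E] [ConditionallyCompleteLattice E]
  [IsOrderedAddMonoid E] [Module ℝ E] [IsOrderedModule ℝ E]

/-- The band projection `P_v` onto the (principal, projection) band generated by `v`:
`P_v z = sup_n (z ∧ n|v|)` for `z ≥ 0`, and `P_v z = P_v z⁺ - P_v z⁻` in general. -/
def bandProj (v z : E) : E :=
  (⨆ n : ℕ, z⁺ ⊓ n • |v|) - (⨆ n : ℕ, z⁻ ⊓ n • |v|)

/-- The projection `P_v^d = I - P_v` onto the disjoint complement of the band of `v`. -/
def bandProjCompl (v z : E) : E := z - bandProj v z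

/-- `P_{x = y} = P_{|x - y|}^d`. -/
def projEq (x y : E) : E → E := bandProjCompl |x - y|

/-- `P_{x ≥ y} = P_{(y - x)⁺}^d`. -/
def projGE (x y : E) : E → E := bandProjCompl (y - x)⁺

/-- `P_{x ≤ y} = P_{(x - y)⁺}^d`. -/
def projLE (x y : E) : E → E := bandProjCompl (x - y)⁺

/-- Order convergence of a sequence in a Riesz space. -/
def OrderTendsto (a : ℕ → E) (l : E) : Prop :=
  ∃ w : ℕ → E, Antitone w ∧ IsGLB (Set.range w) 0 ∧ ∀ n, |a n - l| ≤ w n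

/-- `∑_{n ≥ 0} a n = l`, as order limit of the partial sums. -/
def HasOrderSum (a : ℕ → E) (l : E) : Prop :=
  OrderTendsto (fun N => ∑ n ∈ Finset.range N, a n) l

/-- `e` is a weak order unit and `T` is a strictly positive conditional expectation operator
on the Dedekind complete Riesz space `E`. -/
structure IsConditionalRieszTriple (e : E) (T : E →ₗ[ℝ] E) : Prop where
  unit_nonneg : 0 ≤ e
  weak_unit : ∀ z : E, |z| ⊓ e = 0 → z = 0
  positive : ∀ z : E, 0 ≤ z → 0 ≤ T z
  order_continuous : ∀ D : Set E, D.Nonempty → DirectedOn (· ≥ ·) D → IsGLB D 0 →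
    IsGLB (T '' D) 0
  idempotent : ∀ z : E, T (T z) = T z
  map_unit : T e = e
  range_sup : ∀ a ∈ LinearMap.range T, ∀ b ∈ LinearMap.range T, a ⊔ b ∈ LinearMap.range T
  range_dedekind : ∀ S : Set E, S ⊆ LinearMap.range T → S.Nonempty →
    (∃ b ∈ LinearMap.range T, b ∈ upperBounds S) →
    ∃ c ∈ LinearMap.range T, c ∈ upperBounds S ∧
      ∀ b ∈ LinearMap.range T, b ∈ upperBounds S → c ≤ b
  strictly_positive : ∀ z : E, 0 < z → 0 < T z

/-- The mass function `π_x(t) = T P_{x = te} e`. -/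
def massFn (e : E) (T : E →ₗ[ℝ] E) (x : E) (t : ℝ) : E := T (projEq x (t • e) e)

/-- `x` is natural if `∑_{n ≥ 0} π_x(n) = e`. -/
def IsNatural (e : E) (T : E →ₗ[ℝ] E) (x : E) : Prop :=
  HasOrderSum (fun n : ℕ => massFn e T x n) e

end Projections

section SupCompletion

/-- The sup-completion `E^s` of a Dedekind complete Riesz space `E`. An element `X` of `E^s` is
the supremum of `{y ∈ E : y ≤ X}` and is identified with this set; the sets so obtained are
exactly the nonempty lower sets of `E` that are closed under the suprema that exist in `E`
(by distributivity: if `y ≤ sup A` then `y = sup {y ∧ a : a ∈ A}`). -/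
@[ext]
structure SupCompletion (E : Type*) [Lattice E] where
  carrier : Set E
  nonempty : carrier.Nonempty
  lower : IsLowerSet carrier
  sup_closed : ∀ A ⊆ carrier, A.Nonempty → ∀ a, IsLUB A a → a ∈ carrier

namespace SupCompletion

variable {E : Type*} [Lattice E]

instance : PartialOrder (SupCompletion E) where
  le X Y := X.carrier ⊆ Y.carrier
  le_refl _ := subset_rfl
  le_trans _ _ _ h k := Set.Subset.trans h k
  le_antisymm _ _ h k := SupCompletion.ext (Set.Subset.antisymm h k)

/-- The embedding of `E` into `E^s`. -/
def of (a : E) : SupCompletion E where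
  carrier := Set.Iic a
  nonempty := ⟨a, le_rfl⟩
  lower := isLowerSet_Iic a
  sup_closed := fun _ hA _ _ hb => hb.2 (fun _ hc => hA hc)

instance : Coe E (SupCompletion E) := ⟨of⟩

theorem of_le_iff (a : E) (X : SupCompletion E) : of a ≤ X ↔ a ∈ X.carrier :=
  ⟨fun h => h (Set.mem_Iic.2 le_rfl), fun h _ hb => X.lower hb h⟩

theorem of_le_of (a b : E) : of a ≤ of b ↔ a ≤ b := of_le_iff a (of b)

/-- Suprema in `E^s` of nonempty sets (see `isLUB_sSup`); the value on the empty set, which has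
no supremum in general, is irrelevant. -/
instance [Zero E] : SupSet (SupCompletion E) where
  sSup S := open Classical in
    if h : S.Nonempty then
      { carrier := {y | ∀ Z ∈ upperBounds S, y ∈ Z.carrier}
        nonempty := by
          obtain ⟨X, hX⟩ := h
          obtain ⟨y, hy⟩ := X.nonempty
          exact ⟨y, fun Z hZ => hZ hX hy⟩
        lower := fun _ _ hba ha Z hZ => Z.lower hba (ha Z hZ)
        sup_closed := fun A hA hne a ha Z hZ =>
          Z.sup_closed A (fun b hb => hA hb Z hZ) hne a ha }
    else of 0

theorem isLUB_sSup [Zero E] {S : Set (SupCompletion E)} (h : S.Nonempty) : IsLUB S (sSup S) := by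
  have hc : (sSup S).carrier = {y | ∀ Z ∈ upperBounds S, y ∈ Z.carrier} := by
    simp only [sSup, dif_pos h]
  constructor
  · intro X hX y hy
    rw [hc]
    exact fun Z hZ => hZ hX hy
  · intro Z hZ y hy
    rw [hc] at hy
    exact hy Z hZ

end SupCompletion

end SupCompletion

section Calculus

variable {E : Type*} [AddCommGroup E] [ConditionallyCompleteLattice E]
  [IsOrderedAddMonoid E] [Module ℝ E] [IsOrderedModule ℝ E]

/-- Multiplication of an element of `E^s` by a real number `c ≥ 0`. -/
def SupCompletion.smul (c : ℝ) (X : SupCompletion E) : SupCompletion E :=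
  sSup {Z | ∃ y ∈ X.carrier, Z = SupCompletion.of (c • y)}

/-- The operator `∑ αᵢ P_{vᵢ}` on `E`, a positive combination of band projections, coded by the
list of the pairs `(αᵢ, vᵢ)`. In the `f`-algebra structure with unit `e` it is multiplication by
the positive step element `∑ αᵢ P_{vᵢ} e`. -/
def stepMul (l : List (ℝ≥0 × E)) (b : E) : E :=
  (l.map fun p => (p.1 : ℝ) • bandProj p.2 b).sum

/-- The product of two elements of the positive cone of `E^s`, for the multiplication with unit
`e`: the supremum of the products `p * b`, where `p` runs through the positive step elements
below `X` and `b` through the positive elements of `E` below `Y`. (By Freudenthal's theorem `X`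
is the supremum of these `p`.) -/
def SupCompletion.mul (e : E) (X Y : SupCompletion E) : SupCompletion E :=
  sSup {Z | ∃ (l : List (ℝ≥0 × E)) (b : E), stepMul l e ∈ X.carrier ∧ 0 ≤ b ∧ b ∈ Y.carrier ∧
    Z = SupCompletion.of (stepMul l b)}

/-- The right-continuous spectral system `e_t^x = P_{x ≤ te} e`, with `e_{-∞}^x = 0` and
`e_{∞}^x = e`. -/
def spectralSystem (e x : E) (t : EReal) : E :=
  if t = ⊥ then 0 else if t = ⊤ then e else projLE x (t.toReal • e) e

/-- A multiple `c • 1_J` of the indicator function of a left-open right-closed interval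
`J = {t ∈ ℝ : a < t ≤ b}`, `-∞ ≤ a ≤ b ≤ ∞`. -/
structure StepTerm where
  coeff : ℝ
  left : EReal
  right : EReal
  left_le_right : left ≤ right

/-- The function `c • 1_J` on `ℝ`. -/
def StepTerm.toFun (j : StepTerm) : ℝ → ℝ :=
  Set.indicator {t : ℝ | j.left < (t : EReal) ∧ (t : EReal) ≤ j.right} fun _ => j.coeff

/-- The integral of `c • 1_J` with respect to the spectral system of `x`. -/
def StepTerm.integral (e x : E) (j : StepTerm) : E :=
  j.coeff • (spectralSystem e x j.right - spectralSystem e x j.left)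

/-- The Daniell functional calculus `f(x) = I_x(f) ∈ E^s` for a function `f ≥ 0` that is the
limit of an increasing sequence of step functions (for instance `f` continuous): the supremum of
`I_x(h)` over all step functions `h ≤ f`. It equals `sup_n I_x(f_n)` whenever the step functions
`f_n` increase to `f`. -/
def funCalc (e x : E) (f : ℝ → ℝ) : SupCompletion E :=
  sSup {Z | ∃ h : List StepTerm, (∀ t : ℝ, (h.map fun j => j.toFun t).sum ≤ f t) ∧
    Z = SupCompletion.of (h.map fun j => j.integral e x).sum}

/-- `s^v = f(v)` with `f(t) = s^t`, for real `s > 0` and `v ∈ E`. -/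
def expBase (e : E) (s : ℝ) (v : E) : SupCompletion E := funCalc e v fun t => s ^ t

/-- The generating function `g_x(s) = ∑_{n ≥ 0} s^n π_x(n) ∈ E^s`, `s ≥ 0`; the terms of the
series are positive, so its sum in `E^s` is the supremum of the partial sums. -/
def genFn (e : E) (T : E →ₗ[ℝ] E) (x : E) (s : ℝ) : SupCompletion E :=
  ⨆ N : ℕ, SupCompletion.of (∑ n ∈ Finset.range N, s ^ n • massFn e T x n)

end Calculus

end RieszSpace

end

set_option linter.unusedSectionVars false

noncomputable section

namespace RieszSpace

/-! The proof is the scalar Chernoff argument made local. The components `q_n = P_{x=ne} e` are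
pairwise disjoint, and naturality says that `T q_n` sums to `e`. Hence for `0 ≤ a ≤ e` the element
`T a` is the supremum of `T (a ⊓ ∑_{n<N} q_n)`, and it suffices to bound the finite sums of `z_n = T
(a ⊓ q_n)` (`of_apply_le`).

Take `a = P_{x≥u} e`. Then `z_n ≤ π_x(n)`. On `{x ≥ u} ∩ {x = ne}` one has `u ≤ ne`, and as `u ∈
R(T)`, the operator `T` fixes `P_{u≤ne} e` (`apply_bandProj`), so `z_n ≤ P_{u≤ne} e` as well. For `s
> 1` the multiplier `s^{-u} s^n` is at least `1` there, whence `∑ z_n ≤ s^{-u} ∑ s^n π_x(n)`. The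
case `s < 1` is the mirror image.

Since the product in `E^s` is a supremum over step elements, a step function below `s^t` is needed
that is large enough on every `{u ≤ ne}`. It is written as a telescoping sum over half-lines, and
`sum_smul_mem_mul` multiplies it by a partial sum of the generating function.

For `u = αe` each `z_n` is either zero or has a scalar factor `s^(n-α) ≥ 1`, so no step functions
are needed. -/

theorem inf_eq_zero_of_le {E : Type*} [Lattice E] [Zero E] {a b c d : E} (ha : 0 ≤ a) (hb : 0 ≤ b)
    (hac : a ≤ c) (hbd : b ≤ d) (h : c ⊓ d = 0) : a ⊓ b = 0 :=
  le_antisymm (h ▸ inf_le_inf hac hbd) (le_inf ha hb)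

/-! ### Disjointness in lattice-ordered groups -/

section Lattice

variable {E : Type*} [AddCommGroup E] [Lattice E] [IsOrderedAddMonoid E]

theorem inf_add_le_inf_add_inf {a b c : E} (ha : 0 ≤ a) (hb : 0 ≤ b) (hc : 0 ≤ c) :
    a ⊓ (b + c) ≤ a ⊓ b + a ⊓ c := by
  rw [add_inf, inf_add, inf_add]
  refine le_inf (le_inf ?_ ?_) (le_inf ?_ ?_)
  · exact inf_le_left.trans (le_add_of_nonneg_left ha)
  · exact inf_le_left.trans (le_add_of_nonneg_left hb)
  · exact inf_le_left.trans (le_add_of_nonneg_right hc)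
  · exact inf_le_right

theorem inf_sum_le_sum_inf {ι : Type*} (s : Finset ι) {a : E} {b : ι → E} (ha : 0 ≤ a)
    (hb : ∀ i, 0 ≤ b i) : a ⊓ ∑ i ∈ s, b i ≤ ∑ i ∈ s, a ⊓ b i := by
  classical
  induction s using Finset.induction_on with
  | empty => simp
  | insert i s hi ih =>
    rw [Finset.sum_insert hi, Finset.sum_insert hi]
    exact (inf_add_le_inf_add_inf ha (hb i) (Finset.sum_nonneg fun j _ => hb j)).trans
      (add_le_add le_rfl ih)

theorem inf_add_eq_zero {a b c : E} (ha : 0 ≤ a) (hb : 0 ≤ b) (hc : 0 ≤ c) (hab : a ⊓ b = 0)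
    (hac : a ⊓ c = 0) : a ⊓ (b + c) = 0 := by
  refine le_antisymm ?_ (le_inf ha (add_nonneg hb hc))
  simpa [hab, hac] using inf_add_le_inf_add_inf ha hb hc

theorem inf_nsmul_eq_zero {a b : E} (ha : 0 ≤ a) (hb : 0 ≤ b) (h : a ⊓ b = 0) (n : ℕ) :
    a ⊓ n • b = 0 := by
  induction n with
  | zero => simpa using ha
  | succ n ih =>
    rw [succ_nsmul]
    exact inf_add_eq_zero ha (nsmul_nonneg hb n) hb ih h

theorem add_le_of_inf_eq_zero {a b c : E} (h : a ⊓ b = 0) (ha : a ≤ c) (hb : b ≤ c) :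
    a + b ≤ c := by
  rw [← inf_add_sup, h, zero_add]
  exact sup_le ha hb

theorem sum_le_of_pairwise_inf_eq_zero {p : ℕ → E} {c : E} (hc : 0 ≤ c) (hp : ∀ n, 0 ≤ p n)
    (hpc : ∀ n, p n ≤ c) (h : ∀ m n, m ≠ n → p m ⊓ p n = 0) (N : ℕ) :
    ∑ n ∈ Finset.range N, p n ≤ c := by
  induction N with
  | zero => simpa using hc
  | succ N ih =>
    rw [Finset.sum_range_succ, add_comm]
    refine add_le_of_inf_eq_zero (le_antisymm ?_ ?_) (hpc N) ih
    · refine (inf_sum_le_sum_inf _ (hp N) hp).trans (le_of_eq ?_)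
      exact Finset.sum_eq_zero fun m hm => h N m (Finset.mem_range.1 hm).ne'
    · exact le_inf (hp N) (Finset.sum_nonneg fun n _ => hp n)

end Lattice

/-! ### Principal band projections -/

section BandProjection

variable {E : Type*} [AddCommGroup E] [ConditionallyCompleteLattice E]
  [IsOrderedAddMonoid E]

/-- Archimedean property: the supremum of the multiples of `a` cannot increase when shifted by `a`.
-/
theorem nonpos_of_forall_nsmul_le {a z : E} (h : ∀ n : ℕ, n • a ≤ z) : a ≤ 0 := by
  have hlub : IsLUB (Set.range fun n : ℕ => n • a) (⨆ n : ℕ, n • a) :=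
    isLUB_ciSup ⟨z, by rintro _ ⟨n, rfl⟩; exact h n⟩
  have : (⨆ n : ℕ, n • a) ≤ (⨆ n : ℕ, n • a) - a := by
    refine hlub.2 ?_
    rintro _ ⟨n, rfl⟩
    refine le_sub_iff_add_le.2 ?_
    rw [← succ_nsmul]
    exact hlub.1 ⟨n + 1, rfl⟩
  simpa using this

theorem isLUB_bandProj {v z : E} (hv : 0 ≤ v) (hz : 0 ≤ z) :
    IsLUB (Set.range fun n : ℕ => z ⊓ n • v) (bandProj v z) := by
  have h : bandProj v z = ⨆ n : ℕ, z ⊓ n • v := by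
    have h0 : ∀ n : ℕ, (0 : E) ⊓ n • v = 0 := fun n => inf_eq_left.2 (nsmul_nonneg hv n)
    simp [bandProj, posPart_of_nonneg hz, negPart_of_nonneg hz, abs_of_nonneg hv, h0]
  rw [h]
  exact isLUB_ciSup ⟨z, by rintro _ ⟨n, rfl⟩; exact inf_le_left⟩

theorem bandProj_le {v z : E} (hv : 0 ≤ v) (hz : 0 ≤ z) : bandProj v z ≤ z :=
  (isLUB_bandProj hv hz).2 (by rintro _ ⟨n, rfl⟩; exact inf_le_left)

theorem inf_nsmul_le_bandProj {v z : E} (hv : 0 ≤ v) (hz : 0 ≤ z) (n : ℕ) :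
    z ⊓ n • v ≤ bandProj v z :=
  (isLUB_bandProj hv hz).1 ⟨n, rfl⟩

theorem bandProj_nonneg {v z : E} (hv : 0 ≤ v) (hz : 0 ≤ z) : 0 ≤ bandProj v z := by
  simpa [hz] using inf_nsmul_le_bandProj hv hz 0

theorem bandProjCompl_nonneg {v z : E} (hv : 0 ≤ v) (hz : 0 ≤ z) : 0 ≤ bandProjCompl v z :=
  sub_nonneg.2 (bandProj_le hv hz)

theorem bandProjCompl_le {v z : E} (hv : 0 ≤ v) (hz : 0 ≤ z) : bandProjCompl v z ≤ z :=
  sub_le_self _ (bandProj_nonneg hv hz)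

/-- An element disjoint from `v` is disjoint from each `z ⊓ n • v`, so the two add up to at most
`z`. With `bandProjCompl_inf_eq_zero` this makes `P_v^d z` the largest element of `[0, z]` disjoint
from `v`. -/
theorem le_bandProjCompl {v y z : E} (hv : 0 ≤ v) (hy : 0 ≤ y) (hyz : y ≤ z)
    (h : y ⊓ v = 0) : y ≤ bandProjCompl v z := by
  have hz : 0 ≤ z := hy.trans hyz
  rw [bandProjCompl, le_sub_comm]
  refine (isLUB_bandProj hv hz).2 ?_
  rintro _ ⟨n, rfl⟩
  rw [le_sub_iff_add_le']
  refine add_le_of_inf_eq_zero ?_ hyz inf_le_left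
  exact inf_eq_zero_of_le hy (le_inf hz (nsmul_nonneg hv n)) le_rfl inf_le_right
    (inf_nsmul_eq_zero hy hv h n)

theorem bandProjCompl_inf_eq_zero {v z : E} (hv : 0 ≤ v) (hz : 0 ≤ z) :
    bandProjCompl v z ⊓ v = 0 := by
  refine le_antisymm ?_ (le_inf (bandProjCompl_nonneg hv hz) hv)
  set t := bandProjCompl v z ⊓ v with ht
  have hlub := isLUB_bandProj hv hz
  -- Since `t ≤ v` and `t ≤ z - P_v z`, adding `t` to `z ⊓ n • v` stays below `z ⊓ (n + 1) • v`, so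
  -- the supremum absorbs `t`.
  suffices h : bandProj v z ≤ bandProj v z - t by simpa using h
  refine hlub.2 ?_
  rintro _ ⟨n, rfl⟩
  rw [le_sub_iff_add_le]
  refine le_trans (le_inf ?_ ?_) (inf_nsmul_le_bandProj hv hz (n + 1))
  · calc z ⊓ n • v + t ≤ bandProj v z + bandProjCompl v z :=
          add_le_add (inf_nsmul_le_bandProj hv hz n) inf_le_left
      _ = z := by simp [bandProjCompl]
  · rw [succ_nsmul]
    exact add_le_add inf_le_right inf_le_right

theorem bandProj_inf_bandProjCompl {v z : E} (hv : 0 ≤ v) (hz : 0 ≤ z) :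
    bandProj v z ⊓ bandProjCompl v z = 0 := by
  have h0 : 0 ≤ bandProj v z ⊓ bandProjCompl v z :=
    le_inf (bandProj_nonneg hv hz) (bandProjCompl_nonneg hv hz)
  refine le_antisymm ?_ h0
  have htv : (bandProj v z ⊓ bandProjCompl v z) ⊓ v = 0 :=
    inf_eq_zero_of_le h0 hv inf_le_right le_rfl (bandProjCompl_inf_eq_zero hv hz)
  set t := bandProj v z ⊓ bandProjCompl v z with ht
  suffices h : bandProj v z ≤ bandProj v z - t by simpa using h
  refine (isLUB_bandProj hv hz).2 ?_
  rintro _ ⟨n, rfl⟩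
  rw [le_sub_iff_add_le']
  refine add_le_of_inf_eq_zero ?_ inf_le_left (inf_nsmul_le_bandProj hv hz n)
  exact inf_eq_zero_of_le h0 (le_inf hz (nsmul_nonneg hv n)) le_rfl inf_le_right
    (inf_nsmul_eq_zero h0 hv htv n)

/-- Here `d` is a component of `z`: its multiples do not meet `z - d`, so they meet `z` only inside
`d`. -/
theorem bandProj_le_of_inf_sub_eq_zero {d z : E} (hd : 0 ≤ d) (hdz : d ≤ z)
    (h : d ⊓ (z - d) = 0) : bandProj d z ≤ d := by
  have hz : 0 ≤ z := hd.trans hdz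
  have hc : 0 ≤ z - d := sub_nonneg.2 hdz
  refine (isLUB_bandProj hd hz).2 ?_
  rintro _ ⟨n, rfl⟩
  calc z ⊓ n • d = n • d ⊓ (d + (z - d)) := by rw [inf_comm, add_sub_cancel]
    _ ≤ n • d ⊓ d + n • d ⊓ (z - d) := inf_add_le_inf_add_inf (nsmul_nonneg hd n) hd hc
    _ ≤ d + 0 := by
      refine add_le_add inf_le_right (le_of_eq ?_)
      rw [inf_comm]
      exact inf_nsmul_eq_zero hc hd (by rwa [inf_comm]) n
    _ = d := add_zero d

variable [Module ℝ E] [IsOrderedModule ℝ E]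

theorem le_bandProj_of_le_smul {d b y : E} {C : ℝ} (hd : 0 ≤ d) (hb : 0 ≤ b) (hyb : y ≤ b)
    (hyd : y ≤ C • d) : y ≤ bandProj d b := by
  obtain ⟨n, hn⟩ := exists_nat_ge C
  refine le_trans (le_inf hyb (hyd.trans ?_)) (inf_nsmul_le_bandProj hd hb n)
  rw [← Nat.cast_smul_eq_nsmul ℝ]
  exact smul_le_smul_of_nonneg_right hn hd

end BandProjection

/-! ### Conditional expectation and the components of the unit -/

section Triple

variable {E : Type*} [AddCommGroup E] [ConditionallyCompleteLattice E]
  [IsOrderedAddMonoid E] [Module ℝ E] [IsOrderedModule ℝ E] {e : E} {T : E →ₗ[ℝ] E}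

namespace IsConditionalRieszTriple

theorem mono (hT : IsConditionalRieszTriple e T) {a b : E} (h : a ≤ b) : T a ≤ T b := by
  have := hT.positive (b - a) (sub_nonneg.2 h)
  rwa [map_sub, sub_nonneg] at this

/-- A multiple of `a + b` dominates the weak unit while remaining disjoint from `t`. This replaces
pointwise arguments of the form "these two conditions cannot hold together". -/
theorem eq_zero_of_disjoint (hT : IsConditionalRieszTriple e T) {t a b : E} {δ : ℝ} (hδ : 0 < δ)
    (ht : 0 ≤ t) (ha : 0 ≤ a) (hb : 0 ≤ b) (hta : t ⊓ a = 0) (htb : t ⊓ b = 0)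
    (h : δ • e ≤ a + b) : t = 0 := by
  refine hT.weak_unit t ?_
  rw [abs_of_nonneg ht]
  obtain ⟨n, hn⟩ := exists_nat_ge (1 / δ)
  refine inf_eq_zero_of_le ht hT.unit_nonneg le_rfl ?_
    (inf_nsmul_eq_zero ht (add_nonneg ha hb) (inf_add_eq_zero ht ha hb hta htb) n)
  have h1 : (1 : ℝ) ≤ n * δ := by rwa [div_le_iff₀ hδ] at hn
  calc e = (1 : ℝ) • e := (one_smul ℝ e).symm
    _ ≤ (n * δ : ℝ) • e := smul_le_smul_of_nonneg_right h1 hT.unit_nonneg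
    _ = n • (δ • e) := by rw [mul_smul, Nat.cast_smul_eq_nsmul]
    _ ≤ n • (a + b) := nsmul_le_nsmul_right h n

theorem apply_of_mem_range (hT : IsConditionalRieszTriple e T) {a : E}
    (ha : a ∈ LinearMap.range T) : T a = a := by
  obtain ⟨b, rfl⟩ := ha
  exact hT.idempotent b

theorem unit_mem_range (hT : IsConditionalRieszTriple e T) : e ∈ LinearMap.range T :=
  ⟨e, hT.map_unit⟩

theorem posPart_mem_range (hT : IsConditionalRieszTriple e T) {a : E}
    (ha : a ∈ LinearMap.range T) : a⁺ ∈ LinearMap.range T :=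
  hT.range_sup a ha 0 (zero_mem _)

theorem inf_mem_range (hT : IsConditionalRieszTriple e T) {a b : E}
    (ha : a ∈ LinearMap.range T) (hb : b ∈ LinearMap.range T) : a ⊓ b ∈ LinearMap.range T := by
  have h := neg_mem (hT.range_sup (-a) (neg_mem ha) (-b) (neg_mem hb))
  rwa [← neg_inf, neg_neg] at h

/-- The approximants `e ⊓ n • w` lie in the Riesz subspace `R(T)` and are fixed by `T`; order
continuity carries this to their supremum. -/
theorem apply_bandProj (hT : IsConditionalRieszTriple e T) {w : E}
    (hw : w ∈ LinearMap.range T) (hw0 : 0 ≤ w) : T (bandProj w e) = bandProj w e := by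
  have hlub := isLUB_bandProj hw0 hT.unit_nonneg
  set P := bandProj w e with hP
  have hfix : ∀ n : ℕ, T (e ⊓ n • w) = e ⊓ n • w := fun n =>
    hT.apply_of_mem_range (hT.inf_mem_range hT.unit_mem_range (nsmul_mem hw n))
  refine le_antisymm ?_ ?_
  -- Order continuity is available for families decreasing to zero, so it is applied to the
  -- remainders.
  · have hanti : Antitone fun n : ℕ => P - e ⊓ n • w := fun m n hmn =>
      sub_le_sub_left (inf_le_inf_left _ (nsmul_le_nsmul_left hw0 hmn)) _
    have hglb : IsGLB (Set.range fun n : ℕ => P - e ⊓ n • w) 0 := by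
      constructor
      · rintro _ ⟨n, rfl⟩
        exact sub_nonneg.2 (hlub.1 ⟨n, rfl⟩)
      · intro b hb
        have : P ≤ P - b := hlub.2 (by
          rintro _ ⟨n, rfl⟩
          exact le_sub_comm.1 (hb ⟨n, rfl⟩))
        simpa using this
    have hTglb := hT.order_continuous _ (Set.range_nonempty _)
      (directedOn_range.2 hanti.directed_ge) hglb
    have : T P - P ≤ 0 := hTglb.2 (by
      rintro _ ⟨_, ⟨n, rfl⟩, rfl⟩
      simp only [map_sub, hfix]
      exact sub_le_sub_left (hlub.1 ⟨n, rfl⟩) _)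
    exact sub_nonpos.1 this
  · refine hlub.2 ?_
    rintro _ ⟨n, rfl⟩
    simp only
    rw [← hfix n]
    exact hT.mono (hlub.1 ⟨n, rfl⟩)

theorem apply_bandProjCompl (hT : IsConditionalRieszTriple e T) {w : E}
    (hw : w ∈ LinearMap.range T) (hw0 : 0 ≤ w) : T (bandProjCompl w e) = bandProjCompl w e := by
  rw [bandProjCompl, map_sub, hT.map_unit, hT.apply_bandProj hw hw0]

theorem projEq_unit_nonneg (hT : IsConditionalRieszTriple e T) (x y : E) : 0 ≤ projEq x y e :=
  bandProjCompl_nonneg (abs_nonneg _) hT.unit_nonneg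

theorem projEq_unit_le (hT : IsConditionalRieszTriple e T) (x y : E) : projEq x y e ≤ e :=
  bandProjCompl_le (abs_nonneg _) hT.unit_nonneg

theorem projEq_inf_projEq (hT : IsConditionalRieszTriple e T) (x : E) {r t : ℝ} (h : r ≠ t) :
    projEq x (r • e) e ⊓ projEq x (t • e) e = 0 := by
  have h0 : 0 ≤ projEq x (r • e) e ⊓ projEq x (t • e) e :=
    le_inf (hT.projEq_unit_nonneg _ _) (hT.projEq_unit_nonneg _ _)
  refine hT.eq_zero_of_disjoint (a := |x - r • e|) (b := |x - t • e|)
    (abs_pos.2 (sub_ne_zero.2 h)) h0 (abs_nonneg _) (abs_nonneg _)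
    (inf_eq_zero_of_le h0 (abs_nonneg _) inf_le_left le_rfl
      (bandProjCompl_inf_eq_zero (abs_nonneg _) hT.unit_nonneg))
    (inf_eq_zero_of_le h0 (abs_nonneg _) inf_le_right le_rfl
      (bandProjCompl_inf_eq_zero (abs_nonneg _) hT.unit_nonneg)) ?_
  rcases abs_cases (r - t) with ⟨h1, -⟩ | ⟨h1, -⟩ <;> rw [h1]
  · calc (r - t) • e = (x - t • e) + -(x - r • e) := by rw [sub_smul]; abel
      _ ≤ |x - t • e| + |x - r • e| := add_le_add (le_abs_self _) (neg_le_abs _)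
      _ = _ := add_comm _ _
  · calc (-(r - t)) • e = (x - r • e) + -(x - t • e) := by rw [neg_smul, sub_smul]; abel
      _ ≤ |x - r • e| + |x - t • e| := add_le_add (le_abs_self _) (neg_le_abs _)

theorem inf_projEq_le_bandProjCompl (hT : IsConditionalRieszTriple e T) {x y : E} {v w : E}
    (hv : 0 ≤ v) (hw : 0 ≤ w) (h : w ≤ v + |x - y|) :
    bandProjCompl v e ⊓ projEq x y e ≤ bandProjCompl w e := by
  have h0 : 0 ≤ bandProjCompl v e ⊓ projEq x y e :=
    le_inf (bandProjCompl_nonneg hv hT.unit_nonneg) (hT.projEq_unit_nonneg _ _)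
  refine le_bandProjCompl hw h0 (inf_le_left.trans (bandProjCompl_le hv hT.unit_nonneg)) ?_
  refine inf_eq_zero_of_le h0 hw le_rfl h (inf_add_eq_zero h0 hv (abs_nonneg _) ?_ ?_)
  · exact inf_eq_zero_of_le h0 hv inf_le_left le_rfl (bandProjCompl_inf_eq_zero hv hT.unit_nonneg)
  · exact inf_eq_zero_of_le h0 (abs_nonneg _) inf_le_right le_rfl
      (bandProjCompl_inf_eq_zero (abs_nonneg _) hT.unit_nonneg)

theorem massFn_nonneg (hT : IsConditionalRieszTriple e T) (x : E) (t : ℝ) : 0 ≤ massFn e T x t :=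
  hT.positive _ (hT.projEq_unit_nonneg _ _)

/-- The part of `a` missed by `q = ∑_{n<N} q_n` is at most `e - q`, and `e - T q` is dominated by a
sequence decreasing to zero, by naturality. -/
theorem isLUB_apply_inf_sum_projEq (hT : IsConditionalRieszTriple e T) {x : E}
    (hx : IsNatural e T x) {a : E} (hae : a ≤ e) :
    IsLUB (Set.range fun N : ℕ => T (a ⊓ ∑ n ∈ Finset.range N, projEq x ((n : ℝ) • e) e))
      (T a) := by
  constructor
  · rintro _ ⟨N, rfl⟩
    exact hT.mono inf_le_left
  · intro b hb
    obtain ⟨w, -, hw, hle⟩ := hx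
    rw [← sub_nonpos]
    refine hw.2 ?_
    rintro _ ⟨N, rfl⟩
    set q := ∑ n ∈ Finset.range N, projEq x ((n : ℝ) • e) e with hq
    have hqe : q ≤ e := sum_le_of_pairwise_inf_eq_zero hT.unit_nonneg
      (fun n => hT.projEq_unit_nonneg _ _) (fun n => hT.projEq_unit_le _ _)
      (fun m n hmn => hT.projEq_inf_projEq x (Nat.cast_injective.ne hmn)) N
    have hTq : T q = ∑ n ∈ Finset.range N, massFn e T x n := by
      rw [hq, map_sum]; rfl
    have haq : a - (e - q) ≤ a ⊓ q := by
      refine le_inf (sub_le_self _ (sub_nonneg.2 hqe)) ?_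
      rw [sub_le_iff_le_add]
      simpa using hae
    have h1 : T a - (e - T q) ≤ b := by
      have := (hT.mono haq).trans (hb ⟨N, rfl⟩)
      rwa [map_sub, map_sub, hT.map_unit] at this
    calc T a - b ≤ e - T q := by rw [sub_le_comm]; exact h1
      _ ≤ |T q - e| := by rw [← neg_sub]; exact neg_le_abs _
      _ ≤ w N := by rw [hTq]; exact hle N

end IsConditionalRieszTriple

end Triple

/-! ### Membership in the sup-completion and its products -/

section SupCompletion

namespace SupCompletion

theorem mem_sSup {E : Type*} [Lattice E] [Zero E] {S : Set (SupCompletion E)} {a : E}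
    (h : of a ∈ S) : a ∈ (sSup S).carrier :=
  (of_le_iff a _).1 ((isLUB_sSup ⟨_, h⟩).1 h)

variable {E : Type*} [AddCommGroup E] [ConditionallyCompleteLattice E]
  [IsOrderedAddMonoid E] [Module ℝ E] [IsOrderedModule ℝ E]

theorem mem_of_forall_smul_mem (X : SupCompletion E) {z : E} (hz : 0 ≤ z)
    (h : ∀ r : ℝ, 0 < r → r < 1 → r • z ∈ X.carrier) : z ∈ X.carrier := by
  refine X.sup_closed ((fun r : ℝ => r • z) '' Set.Ioo 0 1) ?_
    (Set.Nonempty.image _ ⟨1 / 2, by norm_num⟩) z ⟨?_, ?_⟩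
  · rintro _ ⟨r, hr, rfl⟩
    exact h r hr.1 hr.2
  · rintro _ ⟨r, hr, rfl⟩
    simpa using smul_le_smul_of_nonneg_right hr.2.le hz
  · intro b hb
    rw [← sub_nonpos]
    refine nonpos_of_forall_nsmul_le (z := z) fun n => ?_
    -- The choice `r = 1 - 1/(n+2)` lies strictly between `0` and `1` even for `n = 0`, and yields
    -- `n (z - b) ≤ z`.
    have hn : (0 : ℝ) < n + 2 := by positivity
    have h1 : (1 - 1 / (n + 2 : ℝ)) • z ≤ b :=
      hb ⟨_, ⟨sub_pos.2 ((div_lt_one hn).2 (by linarith)), sub_lt_self _ (by positivity)⟩, rfl⟩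
    have h2 : z - b ≤ (1 / (n + 2 : ℝ)) • z := by
      rw [sub_smul, one_smul] at h1
      exact sub_le_comm.1 h1
    rw [← Nat.cast_smul_eq_nsmul ℝ]
    calc (n : ℝ) • (z - b) ≤ (n : ℝ) • ((1 / (n + 2 : ℝ)) • z) :=
          smul_le_smul_of_nonneg_left h2 (by positivity)
      _ = (n / (n + 2) : ℝ) • z := by rw [smul_smul, mul_one_div]
      _ ≤ (1 : ℝ) • z :=
          smul_le_smul_of_nonneg_right ((div_le_one hn).2 (by linarith)) hz
      _ = z := one_smul ℝ z

theorem sum_mem_funCalc {e v : E} {f : ℝ → ℝ} {N : ℕ} {c : ℕ → ℝ} {l r : ℕ → EReal}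
    (hlr : ∀ n, l n ≤ r n)
    (h : ∀ t : ℝ, ∑ n ∈ Finset.range N, (if l n < t ∧ t ≤ r n then c n else 0) ≤ f t) :
    ∑ n ∈ Finset.range N, c n • (spectralSystem e v (r n) - spectralSystem e v (l n)) ∈
      (funCalc e v f).carrier := by
  refine mem_sSup ⟨(List.range N).map fun n => ⟨c n, l n, r n, hlr n⟩, fun t => ?_, ?_⟩
  · refine le_trans (le_of_eq ?_) (h t)
    rw [List.map_map]
    simp only [Function.comp_def, StepTerm.toFun, Set.indicator_apply, Set.mem_ofPred_eq]
    rfl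
  · rw [List.map_map]
    rfl

theorem stepMul_map_range (N : ℕ) (c : ℕ → ℝ≥0) (d : ℕ → E) (b : E) :
    stepMul ((List.range N).map fun n => (c n, d n)) b =
      ∑ n ∈ Finset.range N, (c n : ℝ) • bandProj (d n) b := by
  rw [stepMul, List.map_map]
  rfl

/-- Multiplication by the step element `∑ c_n d_n` multiplies `z_m` by at least the sum of those
`c_n` whose component `d_n` contains `z_m`; the relation `R` records such pairs. -/
theorem sum_smul_mem_mul {e : E} {X Y : SupCompletion E} {N : ℕ} {c k : ℕ → ℝ} {d p z : ℕ → E}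
    (R : ℕ → ℕ → Prop) [∀ m n, Decidable (R m n)]
    (hc : ∀ n, 0 ≤ c n) (hk : ∀ n, 0 ≤ k n) (hd : ∀ n, 0 ≤ d n)
    (hde : ∀ n, bandProj (d n) e ≤ d n)
    (hX : ∑ n ∈ Finset.range N, c n • d n ∈ X.carrier)
    (hY : ∑ n ∈ Finset.range N, k n • p n ∈ Y.carrier)
    (hz : ∀ n, 0 ≤ z n) (hzp : ∀ n, z n ≤ p n) (hzd : ∀ m n, R m n → z m ≤ d n) :
    ∑ m ∈ Finset.range N, (k m * ∑ n ∈ Finset.range N, if R m n then c n else 0) • z m ∈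
      (mul e X Y).carrier := by
  have hb : 0 ≤ ∑ m ∈ Finset.range N, k m • p m :=
    Finset.sum_nonneg fun m _ => smul_nonneg (hk m) ((hz m).trans (hzp m))
  refine (mul e X Y).lower ?_ (mem_sSup ⟨(List.range N).map fun n => ((c n).toNNReal, d n),
    ∑ m ∈ Finset.range N, k m • p m, ?_, hb, hY, rfl⟩)
  · rw [stepMul_map_range]
    simp only [Real.coe_toNNReal _ (hc _)]
    have key : ∀ n, ∑ m ∈ Finset.range N, (if R m n then k m else 0) • z m ≤
        bandProj (d n) (∑ m ∈ Finset.range N, k m • p m) := fun n => by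
      -- The selected terms lie below a multiple of `d n`, hence in its band; the crude constant `∑
      -- k m` is enough, as only membership in the band matters.
      refine le_bandProj_of_le_smul (C := ∑ m ∈ Finset.range N, k m) (hd n) hb ?_ ?_
      · refine Finset.sum_le_sum fun m _ => ?_
        split_ifs
        · exact smul_le_smul_of_nonneg_left (hzp m) (hk m)
        · simpa using smul_nonneg (hk m) ((hz m).trans (hzp m))
      · rw [Finset.sum_smul]
        refine Finset.sum_le_sum fun m _ => ?_
        split_ifs with h
        · exact smul_le_smul_of_nonneg_left (hzd m n h) (hk m)
        · simpa using smul_nonneg (hk m) (hd n)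
    refine le_trans (le_of_eq ?_)
      (Finset.sum_le_sum fun n _ => smul_le_smul_of_nonneg_left (key n) (hc n))
    simp only [Finset.smul_sum, Finset.mul_sum, Finset.sum_smul, smul_smul]
    rw [Finset.sum_comm]
    refine Finset.sum_congr rfl fun n _ => Finset.sum_congr rfl fun m _ => ?_
    split_ifs
    · rw [mul_comm]
    · simp
  · rw [stepMul_map_range]
    simp only [Real.coe_toNNReal _ (hc _)]
    exact X.lower (Finset.sum_le_sum fun n _ => smul_le_smul_of_nonneg_left (hde n) (hc n)) hX

theorem sum_mem_genFn (e : E) (T : E →ₗ[ℝ] E) (x : E) (s : ℝ) (N : ℕ) :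
    ∑ n ∈ Finset.range N, s ^ n • massFn e T x n ∈ (genFn e T x s).carrier :=
  mem_sSup ⟨N, rfl⟩

end SupCompletion

end SupCompletion

/-! ### Telescoping sums over half-lines -/

section Telescoping

theorem sum_range_ite_le_sub (a : ℕ → ℝ) (m N : ℕ) :
    ∑ n ∈ Finset.range N, (if m ≤ n then a n - a (n + 1) else 0) =
      if m ≤ N then a m - a N else 0 := by
  induction N with
  | zero => by_cases h : m = 0 <;> simp [h]
  | succ N ih =>
    rw [Finset.sum_range_succ, ih]
    rcases lt_trichotomy m (N + 1) with h | h | h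
    · simp [Nat.le_of_lt_succ h, h.le]
    · simp [h]
    · simp [show ¬ m ≤ N by omega, show ¬ m ≤ N + 1 by omega]

theorem sum_range_ite_lt_sub (b : ℕ → ℝ) (m N : ℕ) :
    ∑ n ∈ Finset.range N, (if n < m then b (n + 1) - b n else 0) = b (min N m) - b 0 := by
  induction N with
  | zero => simp
  | succ N ih =>
    rw [Finset.sum_range_succ, ih]
    by_cases h : N < m
    · rw [if_pos h, min_eq_left h.le, min_eq_left (Nat.succ_le_of_lt h)]; ring
    · rw [if_neg h, min_eq_right (by omega), min_eq_right (by omega), add_zero]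

end Telescoping

/-! ### The Chernoff bounds -/

section Chernoff

variable {E : Type*} [AddCommGroup E] [ConditionallyCompleteLattice E]
  [IsOrderedAddMonoid E] [Module ℝ E] [IsOrderedModule ℝ E] {e : E} {T : E →ₗ[ℝ] E}

theorem spectralSystem_bot (e v : E) : spectralSystem e v ⊥ = 0 := if_pos rfl

theorem spectralSystem_top (e v : E) : spectralSystem e v ⊤ = e := by
  simp [spectralSystem]

theorem spectralSystem_coe (e v : E) (t : ℝ) :
    spectralSystem e v (t : EReal) = projLE v (t • e) e := by
  simp [spectralSystem]

theorem bandProjCompl_antitone {v w z : E} (hv : 0 ≤ v) (hvw : v ≤ w) (hz : 0 ≤ z) :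
    bandProjCompl w z ≤ bandProjCompl v z := by
  have hw := hv.trans hvw
  have h0 := bandProjCompl_nonneg hw hz
  exact le_bandProjCompl hv h0 (bandProjCompl_le hw hz)
    (inf_eq_zero_of_le h0 hv le_rfl hvw (bandProjCompl_inf_eq_zero hw hz))

theorem bandProj_bandProj_le {v z : E} (hv : 0 ≤ v) (hz : 0 ≤ z) :
    bandProj (bandProj v z) z ≤ bandProj v z :=
  bandProj_le_of_inf_sub_eq_zero (bandProj_nonneg hv hz) (bandProj_le hv hz)
    (bandProj_inf_bandProjCompl hv hz)

theorem bandProj_bandProjCompl_le {v z : E} (hv : 0 ≤ v) (hz : 0 ≤ z) :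
    bandProj (bandProjCompl v z) z ≤ bandProjCompl v z := by
  refine bandProj_le_of_inf_sub_eq_zero (bandProjCompl_nonneg hv hz) (bandProjCompl_le hv hz) ?_
  rw [inf_comm, bandProjCompl, sub_sub_cancel]
  exact bandProj_inf_bandProjCompl hv hz

namespace IsConditionalRieszTriple

theorem of_apply_le (hT : IsConditionalRieszTriple e T) {x a : E} (hx : IsNatural e T x)
    (ha : 0 ≤ a) (hae : a ≤ e) (X : SupCompletion E)
    (h : ∀ N, ∑ n ∈ Finset.range N, T (a ⊓ projEq x ((n : ℝ) • e) e) ∈ X.carrier) :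
    SupCompletion.of (T a) ≤ X := by
  rw [SupCompletion.of_le_iff]
  refine X.sup_closed _ ?_ (Set.range_nonempty _) _ (hT.isLUB_apply_inf_sum_projEq hx hae)
  rintro _ ⟨N, rfl⟩
  refine X.lower ?_ (h N)
  simp only
  rw [← map_sum]
  exact hT.mono (inf_sum_le_sum_inf _ ha fun n => hT.projEq_unit_nonneg _ _)

/-- From `u ≤ x` and `x = y` follows `u ≤ y`, a condition on elements of `R(T)` alone, whose
component of `e` is fixed by `T`. -/
theorem apply_projGE_inf_le (hT : IsConditionalRieszTriple e T) (x : E) {u y : E}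
    (hu : u ∈ LinearMap.range T) (hy : y ∈ LinearMap.range T) :
    T (projGE x u e ⊓ projEq x y e) ≤ projLE u y e := by
  have hmem := hT.posPart_mem_range (sub_mem hu hy)
  rw [projLE, ← hT.apply_bandProjCompl hmem (posPart_nonneg _)]
  refine hT.mono (hT.inf_projEq_le_bandProjCompl (posPart_nonneg _) (posPart_nonneg _) ?_)
  refine sup_le ?_ (add_nonneg (posPart_nonneg _) (abs_nonneg _))
  calc u - y = (u - x) + (x - y) := by abel
    _ ≤ _ := add_le_add (le_posPart _) (le_abs_self _)

theorem apply_projLE_inf_le (hT : IsConditionalRieszTriple e T) (x : E) {u y : E}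
    (hu : u ∈ LinearMap.range T) (hy : y ∈ LinearMap.range T) :
    T (projLE x u e ⊓ projEq x y e) ≤ projLE y u e := by
  have hmem := hT.posPart_mem_range (sub_mem hy hu)
  rw [projLE, projLE, ← hT.apply_bandProjCompl hmem (posPart_nonneg _)]
  refine hT.mono (hT.inf_projEq_le_bandProjCompl (posPart_nonneg _) (posPart_nonneg _) ?_)
  refine sup_le ?_ (add_nonneg (posPart_nonneg _) (abs_nonneg _))
  calc y - u = (x - u) + -(x - y) := by abel
    _ ≤ _ := add_le_add (le_posPart _) (neg_le_abs _)

theorem smul_unit_mem_range (hT : IsConditionalRieszTriple e T) (r : ℝ) :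
    r • e ∈ LinearMap.range T :=
  Submodule.smul_mem _ r hT.unit_mem_range

/-- This is `{u ≤ r} ⊆ {u < t}`: outside both `{u > r}` and `{u < t}` nothing remains, as `(u - re)⁺
+ (te - u)⁺ ≥ (t - r)e`. -/
theorem projLE_unit_le_bandProj (hT : IsConditionalRieszTriple e T) (u : E) {r t : ℝ}
    (h : r < t) : projLE u (r • e) e ≤ bandProj (t • e - u)⁺ e := by
  have hv := posPart_nonneg (u - r • e)
  have hw := posPart_nonneg (t • e - u)
  have hd := bandProjCompl_nonneg hv hT.unit_nonneg
  have h0 : 0 ≤ projLE u (r • e) e ⊓ bandProjCompl (t • e - u)⁺ e :=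
    le_inf hd (bandProjCompl_nonneg hw hT.unit_nonneg)
  have hz : projLE u (r • e) e ⊓ bandProjCompl (t • e - u)⁺ e = 0 := by
    refine hT.eq_zero_of_disjoint (sub_pos.2 h) h0 hv hw
      (inf_eq_zero_of_le h0 hv inf_le_left le_rfl (bandProjCompl_inf_eq_zero hv hT.unit_nonneg))
      (inf_eq_zero_of_le h0 hw inf_le_right le_rfl (bandProjCompl_inf_eq_zero hw hT.unit_nonneg))
      ?_
    calc (t - r) • e = (u - r • e) + (t • e - u) := by rw [sub_smul]; abel
      _ ≤ _ := add_le_add (le_posPart _) (le_posPart _)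
  have := add_le_of_inf_eq_zero hz (bandProjCompl_le hv hT.unit_nonneg)
    (bandProjCompl_le hw hT.unit_nonneg)
  rw [bandProjCompl, ← add_sub_assoc, sub_le_iff_le_add, add_comm] at this
  exact le_of_add_le_add_left this

theorem projLE_smul_unit_eq_zero (hT : IsConditionalRieszTriple e T) {r t : ℝ} (h : t < r) :
    projLE (r • e) (t • e) e = 0 := by
  have hv := posPart_nonneg (r • e - t • e)
  have h0 := bandProjCompl_nonneg hv hT.unit_nonneg
  refine hT.eq_zero_of_disjoint (sub_pos.2 h) h0 hv le_rfl
    (bandProjCompl_inf_eq_zero hv hT.unit_nonneg) (inf_eq_right.2 h0) ?_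
  rw [add_zero, sub_smul]
  exact le_posPart _

theorem chernoff_projGE (hT : IsConditionalRieszTriple e T) {x u : E} (hx : IsNatural e T x)
    (hu : u ∈ LinearMap.range T) {s : ℝ} (hs : 1 < s) :
    SupCompletion.of (T (projGE x u e)) ≤
      SupCompletion.mul e (expBase e s (-u)) (genFn e T x s) := by
  have hs0 : 0 < s := one_pos.trans hs
  have he := hT.unit_nonneg
  have ha : 0 ≤ projGE x u e := bandProjCompl_nonneg (posPart_nonneg _) he
  refine hT.of_apply_le hx ha (bandProjCompl_le (posPart_nonneg _) he) _ fun N => ?_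
  set z : ℕ → E := fun n => T (projGE x u e ⊓ projEq x ((n : ℝ) • e) e) with hz
  have hz0 : ∀ n, 0 ≤ z n := fun n =>
    hT.positive _ (le_inf ha (hT.projEq_unit_nonneg _ _))
  refine SupCompletion.mem_of_forall_smul_mem _ (Finset.sum_nonneg fun n _ => hz0 n)
    fun r hr0 hr1 => ?_
  -- Spectral intervals are left-open, so `{-u ≥ -n}` is enlarged to `{-u > -(n + ε)}`. This costs
  -- the factor `s^(-ε) = r < 1`, which is removed by letting `r` tend to `1`.
  obtain ⟨ε, hε, rfl⟩ : ∃ ε : ℝ, 0 < ε ∧ s ^ (-ε) = r :=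
    ⟨-Real.logb s r, neg_pos.2 (Real.logb_neg hs hr0 hr1), by
      rw [neg_neg, Real.rpow_logb hs0 hs.ne' hr0]⟩
  -- Truncation at `N` makes the last term vanish, so that the differences from `m` on add up to
  -- exactly `s^(-m)` for `m < N`.
  set a : ℕ → ℝ := fun n => if n < N then (s ^ n)⁻¹ else 0 with haDef
  have ha0 : ∀ n, 0 ≤ a n := fun n => by
    simp only [haDef]; split_ifs <;> positivity
  have haN : a N = 0 := by simp [haDef]
  have ha_le : ∀ n, a n ≤ (s ^ n)⁻¹ := fun n => by
    simp only [haDef]; split_ifs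
    · exact le_rfl
    · positivity
  have ha_anti : ∀ n, a (n + 1) ≤ a n := fun n => by
    by_cases h : n < N
    · refine (ha_le _).trans ?_
      simp only [haDef, if_pos h]
      exact inv_anti₀ (by positivity) (pow_le_pow_right₀ hs.le n.le_succ)
    · have : a (n + 1) = 0 := if_neg (by omega)
      rw [this]; exact ha0 n
  have hX : ∑ n ∈ Finset.range N,
      (s ^ (-ε) * (a n - a (n + 1))) • bandProj ((n + ε) • e - u)⁺ e ∈
        (expBase e s (-u)).carrier := by
    have := SupCompletion.sum_mem_funCalc (e := e) (v := -u) (f := fun t => s ^ t) (N := N)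
      (c := fun n => s ^ (-ε) * (a n - a (n + 1))) (l := fun n => ((-(n + ε) : ℝ) : EReal))
      (r := fun _ => ⊤) (fun _ => le_top) ?_
    · refine Set.mem_of_eq_of_mem (Finset.sum_congr rfl fun n _ => ?_) this
      rw [spectralSystem_top, spectralSystem_coe, projLE,
        bandProjCompl, sub_sub_cancel, neg_smul, sub_neg_eq_add, neg_add_eq_sub]
    · intro t
      have hex : ∃ n : ℕ, -(n + ε) < t := by
        obtain ⟨n, hn⟩ := exists_nat_gt (-t)
        exact ⟨n, by linarith⟩
      -- The half-lines containing `t` are those with index `n ≥ M`; there the step function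
      -- telescopes to at most `s^(-(M + ε)) ≤ s^t`.
      obtain ⟨M, hM, hiff⟩ : ∃ M : ℕ, -(M + ε) < t ∧ ∀ n : ℕ, -((n : ℝ) + ε) < t ↔ M ≤ n := by
        classical
        refine ⟨Nat.find hex, Nat.find_spec hex, fun n => ⟨Nat.find_min' hex, fun h => ?_⟩⟩
        have h1 := Nat.find_spec hex
        have h2 : (Nat.find hex : ℝ) ≤ n := Nat.cast_le.2 h
        linarith
      simp only [EReal.coe_lt_coe_iff, le_top, and_true, hiff]
      calc _ = s ^ (-ε) * ∑ n ∈ Finset.range N,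
            (if M ≤ n then a n - a (n + 1) else 0) := by
              simp only [Finset.mul_sum, mul_ite, mul_zero]
        _ ≤ s ^ (-ε) * (s ^ M)⁻¹ := by
              refine mul_le_mul_of_nonneg_left ?_ hr0.le
              rw [sum_range_ite_le_sub, haN, sub_zero]
              split_ifs
              · exact ha_le _
              · positivity
        _ = s ^ (-(M + ε)) := by
              rw [neg_add, Real.rpow_add hs0, Real.rpow_neg hs0.le (M : ℝ),
                Real.rpow_natCast, mul_comm]
        _ ≤ s ^ t := Real.rpow_le_rpow_of_exponent_le hs.le hM.le
  have key := SupCompletion.sum_smul_mem_mul (z := z) (fun m n => m ≤ n)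
    (fun n => mul_nonneg hr0.le (sub_nonneg.2 (ha_anti n))) (fun n => pow_nonneg hs0.le n)
    (fun n => bandProj_nonneg (posPart_nonneg _) he)
    (fun n => bandProj_bandProj_le (posPart_nonneg _) he) hX
    (SupCompletion.sum_mem_genFn e T x s N) hz0 (fun n => hT.mono inf_le_right) ?_
  · convert key using 1
    rw [Finset.smul_sum]
    refine Finset.sum_congr rfl fun m hm => ?_
    have hmN := Finset.mem_range.1 hm
    congr 1
    simp only [← mul_ite_zero, ← Finset.mul_sum]
    rw [sum_range_ite_le_sub, if_pos hmN.le, haN, sub_zero]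
    simp only [haDef, if_pos hmN]
    field_simp
  · intro m n hmn
    refine (hT.apply_projGE_inf_le x hu (hT.smul_unit_mem_range m)).trans
      (hT.projLE_unit_le_bandProj u ?_)
    have : (m : ℝ) ≤ n := by exact_mod_cast hmn
    linarith

theorem chernoff_projLE (hT : IsConditionalRieszTriple e T) {x u : E} (hx : IsNatural e T x)
    (hu : u ∈ LinearMap.range T) {s : ℝ} (hs0 : 0 < s) (hs : s < 1) :
    SupCompletion.of (T (projLE x u e)) ≤
      SupCompletion.mul e (expBase e s (-u)) (genFn e T x s) := by
  have he := hT.unit_nonneg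
  have ha : 0 ≤ projLE x u e := bandProjCompl_nonneg (posPart_nonneg _) he
  refine hT.of_apply_le hx ha (bandProjCompl_le (posPart_nonneg _) he) _ fun N => ?_
  set z : ℕ → E := fun n => T (projLE x u e ⊓ projEq x ((n : ℝ) • e) e) with hz
  have hz0 : ∀ n, 0 ≤ z n := fun n =>
    hT.positive _ (le_inf ha (hT.projEq_unit_nonneg _ _))
  -- The shift with `b 0 = 0` makes the increments with index `n < m + 1` add up to `s^(-m)`. The
  -- half-lines `t ≤ -n` are right-closed, so no `ε` is needed here.
  set b : ℕ → ℝ := fun n => Nat.casesOn n 0 fun m => (s ^ m)⁻¹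
  have hb_mono : Monotone b := monotone_nat_of_le_succ fun n => by
    cases n with
    | zero => simp [b]
    | succ n =>
      exact inv_anti₀ (by positivity) (pow_le_pow_of_le_one hs0.le hs.le n.le_succ)
  have hX : ∑ n ∈ Finset.range N, (b (n + 1) - b n) • projLE ((n : ℝ) • e) u e ∈
      (expBase e s (-u)).carrier := by
    have := SupCompletion.sum_mem_funCalc (e := e) (v := -u) (f := fun t => s ^ t) (N := N)
      (c := fun n => b (n + 1) - b n) (l := fun _ => ⊥) (r := fun n => ((-n : ℝ) : EReal))
      (fun _ => bot_le) ?_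
    · refine Set.mem_of_eq_of_mem (Finset.sum_congr rfl fun n _ => ?_) this
      rw [spectralSystem_bot, spectralSystem_coe, projLE, projLE,
        sub_zero, neg_smul, sub_neg_eq_add, neg_add_eq_sub]
    · intro t
      have hex : ∃ n : ℕ, ¬ t ≤ -n := by
        obtain ⟨n, hn⟩ := exists_nat_gt (-t)
        exact ⟨n, by linarith⟩
      obtain ⟨M, hiff⟩ : ∃ M : ℕ, ∀ n : ℕ, t ≤ -(n : ℝ) ↔ n < M := by
        classical
        refine ⟨Nat.find hex, fun n => ⟨fun h => ?_, fun h => not_not.1 (Nat.find_min hex h)⟩⟩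
        by_contra hlt
        have h2 : (Nat.find hex : ℝ) ≤ n := Nat.cast_le.2 (not_lt.1 hlt)
        exact Nat.find_spec hex (by linarith)
      simp only [EReal.coe_le_coe_iff, EReal.bot_lt_coe, true_and, hiff]
      rw [sum_range_ite_lt_sub]
      refine (sub_le_self _ le_rfl).trans ((hb_mono (min_le_right _ _)).trans ?_)
      -- For `M = 0` the point `t` lies in none of the half-lines and the step function vanishes;
      -- otherwise `j` is the largest index with `t ≤ -j`.
      rcases M with _ | j
      · exact (Real.rpow_pos_of_pos hs0 t).le
      · have hj : t ≤ -(j : ℝ) := (hiff j).2 (by omega)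
        calc b (j + 1) = s ^ (-(j : ℝ)) := by
              rw [Real.rpow_neg hs0.le, Real.rpow_natCast]
          _ ≤ s ^ t := Real.rpow_le_rpow_of_exponent_ge hs0 hs.le hj
  have key := SupCompletion.sum_smul_mem_mul (z := z) (fun m n => n < m + 1)
    (fun n => sub_nonneg.2 (hb_mono n.le_succ)) (fun n => pow_nonneg hs0.le n)
    (fun n => bandProjCompl_nonneg (posPart_nonneg _) he)
    (fun n => bandProj_bandProjCompl_le (posPart_nonneg _) he) hX
    (SupCompletion.sum_mem_genFn e T x s N) hz0 (fun n => hT.mono inf_le_right) ?_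
  · convert key using 1
    refine Finset.sum_congr rfl fun m hm => ?_
    rw [sum_range_ite_lt_sub, min_eq_right (Finset.mem_range.1 hm)]
    change z m = (s ^ m * ((s ^ m)⁻¹ - 0)) • z m
    rw [sub_zero, mul_inv_cancel₀ (by positivity), one_smul]
  · intro m n hmn
    refine (hT.apply_projLE_inf_le x hu (hT.smul_unit_mem_range m)).trans
      (bandProjCompl_antitone (posPart_nonneg _) (posPart_mono (sub_le_sub_right ?_ _)) he)
    exact smul_le_smul_of_nonneg_right (by exact_mod_cast Nat.le_of_lt_succ hmn) he

theorem of_apply_le_smul_genFn (hT : IsConditionalRieszTriple e T) {x a : E}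
    (hx : IsNatural e T x) (ha : 0 ≤ a) (hae : a ≤ e) {s α : ℝ} (hs : 0 < s)
    (h : ∀ n : ℕ, T (a ⊓ projEq x ((n : ℝ) • e) e) = 0 ∨ s ^ α ≤ s ^ n) :
    SupCompletion.of (T a) ≤ SupCompletion.smul (1 / s ^ α) (genFn e T x s) := by
  refine hT.of_apply_le hx ha hae _ fun N => ?_
  refine SupCompletion.lower _ ?_
    (SupCompletion.mem_sSup ⟨_, SupCompletion.sum_mem_genFn e T x s N, rfl⟩)
  rw [Finset.smul_sum]
  refine Finset.sum_le_sum fun n _ => ?_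
  have hα := Real.rpow_pos_of_pos hs α
  have hm := hT.massFn_nonneg x n
  rw [smul_smul]
  rcases h n with h | h
  · rw [h]
    exact smul_nonneg (by positivity) hm
  · calc T (a ⊓ projEq x ((n : ℝ) • e) e) ≤ (1 : ℝ) • massFn e T x n := by
          rw [one_smul]; exact hT.mono inf_le_right
      _ ≤ _ := smul_le_smul_of_nonneg_right (by rwa [one_div_mul_eq_div, one_le_div hα]) hm

theorem chernoff_projGE_smul_unit (hT : IsConditionalRieszTriple e T) {x : E}
    (hx : IsNatural e T x) (α : ℝ) {s : ℝ} (hs : 1 < s) :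
    SupCompletion.of (T (projGE x (α • e) e)) ≤
      SupCompletion.smul (1 / s ^ α) (genFn e T x s) := by
  have he := hT.unit_nonneg
  have ha : 0 ≤ projGE x (α • e) e := bandProjCompl_nonneg (posPart_nonneg _) he
  refine hT.of_apply_le_smul_genFn hx ha (bandProjCompl_le (posPart_nonneg _) he)
    (one_pos.trans hs) fun n => ?_
  rcases lt_or_ge (n : ℝ) α with h | h
  · refine .inl (le_antisymm ?_ (hT.positive _ (le_inf ha (hT.projEq_unit_nonneg _ _))))
    rw [← hT.projLE_smul_unit_eq_zero h]
    exact hT.apply_projGE_inf_le x (hT.smul_unit_mem_range α) (hT.smul_unit_mem_range n)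
  · right
    rw [← Real.rpow_natCast]
    exact Real.rpow_le_rpow_of_exponent_le hs.le h

theorem chernoff_projLE_smul_unit (hT : IsConditionalRieszTriple e T) {x : E}
    (hx : IsNatural e T x) (α : ℝ) {s : ℝ} (hs0 : 0 < s) (hs : s < 1) :
    SupCompletion.of (T (projLE x (α • e) e)) ≤
      SupCompletion.smul (1 / s ^ α) (genFn e T x s) := by
  have he := hT.unit_nonneg
  have ha : 0 ≤ projLE x (α • e) e := bandProjCompl_nonneg (posPart_nonneg _) he
  refine hT.of_apply_le_smul_genFn hx ha (bandProjCompl_le (posPart_nonneg _) he) hs0 fun n => ?_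
  rcases lt_or_ge α (n : ℝ) with h | h
  · refine .inl (le_antisymm ?_ (hT.positive _ (le_inf ha (hT.projEq_unit_nonneg _ _))))
    rw [← hT.projLE_smul_unit_eq_zero h]
    exact hT.apply_projLE_inf_le x (hT.smul_unit_mem_range α) (hT.smul_unit_mem_range n)
  · right
    rw [← Real.rpow_natCast]
    exact Real.rpow_le_rpow_of_exponent_ge hs0 hs.le h

end IsConditionalRieszTriple

end Chernoff

end RieszSpace

end

theorem mainTheorem3 {E : Type*} [AddCommGroup E] [ConditionallyCompleteLattice E]
    [IsOrderedAddMonoid E] [Module ℝ E] [IsOrderedModule ℝ E]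
    (e : E) (T : E →ₗ[ℝ] E) (hT : RieszSpace.IsConditionalRieszTriple e T)
    (x : E) (hx : RieszSpace.IsNatural e T x) :
    (∀ u ∈ LinearMap.range T,
      (∀ s : ℝ, 1 < s →
        RieszSpace.SupCompletion.of (T (RieszSpace.projGE x u e)) ≤
          RieszSpace.SupCompletion.mul e (RieszSpace.expBase e s (-u))
            (RieszSpace.genFn e T x s)) ∧
      (∀ s : ℝ, 0 < s → s < 1 →
        RieszSpace.SupCompletion.of (T (RieszSpace.projLE x u e)) ≤
          RieszSpace.SupCompletion.mul e (RieszSpace.expBase e s (-u))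
            (RieszSpace.genFn e T x s))) ∧
    (∀ α : ℝ, 0 ≤ α →
      (∀ s : ℝ, 1 < s →
        RieszSpace.SupCompletion.of (T (RieszSpace.projGE x (α • e) e)) ≤
          RieszSpace.SupCompletion.smul (1 / s ^ α) (RieszSpace.genFn e T x s)) ∧
      (∀ s : ℝ, 0 < s → s < 1 →
        RieszSpace.SupCompletion.of (T (RieszSpace.projLE x (α • e) e)) ≤
          RieszSpace.SupCompletion.smul (1 / s ^ α) (RieszSpace.genFn e T x s))) := by
  exact ⟨fun _ hu => ⟨fun _ hs => hT.chernoff_projGE hx hu hs,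
      fun _ hs0 hs => hT.chernoff_projLE hx hu hs0 hs⟩,
    fun α _ => ⟨fun _ hs => hT.chernoff_projGE_smul_unit hx α hs,
      fun _ hs0 hs => hT.chernoff_projLE_smul_unit hx α hs0 hs⟩⟩
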